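/- **Setting.** Let $k,\ell,m\ge 0$ be integers (for $m=0$ nothing can be rejected and the claim is trivial), $n=k+\ell$, and let $Z=(Z_1,\dots,Z_{n+m})=(Y_1,\dots,Y_n,X_1,\dots,X_m)$ be a random vector with values in $\mathcal Z^{n+m}$, where $\mathcal Z$ is a measurable space, with joint distribution $P$. All $Y_i$ have the same marginal distribution $P_0$. Let $\mathcal H_0=\{j: X_j\sim P_0\}$ and $\mathcal H_1=\{1,\dots,m\}\setminus\mathcal H_0$. Let $g(z,(z_1,\dots,z_k),(z_{k+1},\dots,z_{n+m}))\in\mathbb R$ be a measurable score function that is invariant under permutations of $(z_{k+1},\dots,z_{n+m})$. Define the scores $S_i=g(Z_i,(Z_1,\dots,Z_k),(Z_{k+1},\dots,Z_{n+m}))$ for $k+1\le i\le n+m$ and the empirical $p$-values $$p_j=\frac{1}{\ell+1}\Big(1+\sum_{i=k+1}^{n}\mathbf 1\{S_i>S_{n+j}\}\Big),\qquad 1\le j\le m .$$ For $a\ge 0$, the BH procedure at level $a$ rejects $\{i: p_i\le a\hat k/m\}$, where $\hat k=\max\{r\in\{0,\dots,m\}:\sum_{i=1}^m\mathbf 1\{p_i\le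 a r/m\}\ge r\}$. For a target level $\alpha>0$, *Storey-AdaDetect* with parameter $\lambda\in(0,1)$ and *Quantile-AdaDetect* with parameter $k_0\in\{1,\dots,m\}$ are the BH procedure applied to $p_1,\dots,p_m$ at the level $\alpha/\hat\pi_0$, where respectively $$\hat\pi_0=\frac{1+\sum_{i=1}^m\mathbf 1\{p_i\ge\lambda\}}{m(1-\lambda)},\qquad \hat\pi_0=\frac{m-k_0+1}{m(1-p_{(k_0)})},$$ $p_{(k_0)}$ being the $k_0$-th smallest $p$-value; if $p_{(k_0)}=1$, then $\hat\pi_0=\infty$ and $\alpha/\hat\pi_0=0$. A measurable procedure $R=R(Z)\subseteq\{1,\dots,m\}$ controls the FDR at level $\alpha$ if $\mathbb E\big[\,|R\cap\mathcal H_0|/(1\vee|R|)\,\big]\le\alpha$. **Corollary 3.5.** Assume that $(Y_1,\dots,Y_n,X_i,\ i\in\mathcal H_0)$ is exchangeable conditionally on $(X_i,\ i\in\mathcal H_1)$, and that $S_{k+1},\dots,S_{n+m}$ have no ties almost surely. Then, for every $\alpha>0$: 1. Storey-AdaDetect controls the FDR at level $\alpha$ for every $\lambda=K/(\ell+1)$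 with $K\in\{2,\dots,\ell\}$. 2. Quantile-AdaDetect controls the FDR at level $\alpha$ for every $k_0\in\{1,\dots,m\}$. -/

import Mathlib

open MeasureTheory ProbabilityTheory
open scoped ENNReal

namespace AdaDetect

/-- Positions of the full sample `Z = (Y₁, …, Y_n, X₁, …, X_m)`, where `n = k + ℓ`:
`Sum.inl i` is a position of the first null sample `(Y₁, …, Y_k)`, `Sum.inr (Sum.inl i)` one of the
second null sample `(Y_{k+1}, …, Y_n)`, and `Sum.inr (Sum.inr j)` one of the test sample. -/
abbrev Pos (k ℓ m : ℕ) : Type := Fin k ⊕ (Fin ℓ ⊕ Fin m)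

section Model

variable {𝒵 : Type*} [MeasurableSpace 𝒵] {k ℓ m : ℕ}

/-- All observations of the null training sample have marginal distribution `P₀`, where `P` is the
joint distribution of the full sample. -/
def NullMarginal (P : Measure (Pos k ℓ m → 𝒵)) (P₀ : Measure 𝒵) : Prop :=
  (∀ i : Fin k, P.map (fun z => z (Sum.inl i)) = P₀) ∧
    ∀ i : Fin ℓ, P.map (fun z => z (Sum.inr (Sum.inl i))) = P₀

/-- The set `𝓗₀` of true nulls: the test observations with marginal distribution `P₀`. -/
def trueNulls (P : Measure (Pos k ℓ m → 𝒵)) (P₀ : Measure 𝒵) : Set (Fin m) :=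
  {j | P.map (fun z => z (Sum.inr (Sum.inr j))) = P₀}

/-- The positions of `(Y₁, …, Y_n, X_j, j ∈ H)`. -/
def nullPositions (k ℓ : ℕ) {m : ℕ} (H : Set (Fin m)) : Set (Pos k ℓ m) :=
  {a | ∀ j : Fin m, a = Sum.inr (Sum.inr j) → j ∈ H}

/-- Under `P`, the coordinates in `N` are exchangeable conditionally on the coordinates outside
`N`: permuting the coordinates in `N` does not change the conditional probability, given the
coordinates outside `N`, that the subfamily indexed by `N` lies in a measurable set. -/
def CondExchangeable {ι : Type*} (P : Measure (ι → 𝒵)) (N : Set ι) : Prop :=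
  ∀ σ : Equiv.Perm N, ∀ A : Set (N → 𝒵), MeasurableSet A →
    P⟦{z | (fun i : N => z (σ i)) ∈ A} |
        MeasurableSpace.comap (fun (z : ι → 𝒵) (i : (Nᶜ : Set ι)) => z i) inferInstance⟧
      =ᵐ[P]
    P⟦{z | (fun i : N => z i) ∈ A} |
        MeasurableSpace.comap (fun (z : ι → 𝒵) (i : (Nᶜ : Set ι)) => z i) inferInstance⟧

/-- The false discovery proportion of a rejection set `R` when the set of true nulls is `H`. -/
noncomputable def FDP (H : Set (Fin m)) (R : Finset (Fin m)) : ℝ :=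
  open Classical in ((R.filter (· ∈ H)).card : ℝ) / (max 1 R.card : ℕ)

/-- The false discovery rate of the procedure `R` under the joint distribution `P`. -/
noncomputable def FDR (P : Measure (Pos k ℓ m → 𝒵)) (P₀ : Measure 𝒵)
    (R : (Pos k ℓ m → 𝒵) → Finset (Fin m)) : ℝ :=
  ∫ z, FDP (trueNulls P P₀) (R z) ∂P

/-- `R` is a measurable procedure whose false discovery rate under `P` is at most `α`. -/
def ControlsFDR (P : Measure (Pos k ℓ m → 𝒵)) (P₀ : Measure 𝒵)
    (R : (Pos k ℓ m → 𝒵) → Finset (Fin m)) (α : ℝ) : Prop :=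
  (∀ j : Fin m, MeasurableSet {z | j ∈ R z}) ∧ FDR P P₀ R ≤ α

/-- A score function `g(z, (z₁, …, z_k), (z_{k+1}, …, z_{n+m}))`: jointly measurable, and invariant
under permutations of `(z_{k+1}, …, z_{n+m})`. -/
structure IsScoreFunction (g : 𝒵 → (Fin k → 𝒵) → (Fin ℓ ⊕ Fin m → 𝒵) → ℝ) : Prop where
  measurable : Measurable
    fun q : 𝒵 × (Fin k → 𝒵) × (Fin ℓ ⊕ Fin m → 𝒵) => g q.1 q.2.1 q.2.2
  invariant : ∀ (π : Equiv.Perm (Fin ℓ ⊕ Fin m)) (z : 𝒵) (a : Fin k → 𝒵)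
    (b : Fin ℓ ⊕ Fin m → 𝒵), g z a (fun i => b (π i)) = g z a b

/-- The scores `(S_{k+1}, …, S_{n+m})` computed from the full sample `z`. -/
def scores (g : 𝒵 → (Fin k → 𝒵) → (Fin ℓ ⊕ Fin m → 𝒵) → ℝ) (z : Pos k ℓ m → 𝒵)
    (i : Fin ℓ ⊕ Fin m) : ℝ :=
  g (z (Sum.inr i)) (fun a => z (Sum.inl a)) (fun b => z (Sum.inr b))

/-- The scores have no ties almost surely. -/
def NoTies (P : Measure (Pos k ℓ m → 𝒵))
    (g : 𝒵 → (Fin k → 𝒵) → (Fin ℓ ⊕ Fin m → 𝒵) → ℝ) : Prop :=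
  ∀ᵐ z ∂P, Function.Injective (scores g z)

end Model

section Procedures

variable {ℓ m : ℕ}

/-- The empirical p-values `p_j = (1 + #{i : S_i > S_{n+j}}) / (ℓ + 1)`, where `i` runs over the
second null sample. -/
noncomputable def empPValue (S : Fin ℓ ⊕ Fin m → ℝ) (j : Fin m) : ℝ :=
  (1 + ((Finset.univ.filter fun i : Fin ℓ => S (Sum.inl i) > S (Sum.inr j)).card : ℝ)) /
    ((ℓ : ℝ) + 1)

/-- `k̂ = max {r ∈ {0, …, m} : #{i : p_i ≤ α r / m} ≥ r}`; the maximum is over a set containing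
`0`. -/
noncomputable def bhCount (α : ℝ) (p : Fin m → ℝ) : ℕ :=
  ((Finset.range (m + 1)).filter fun r : ℕ =>
    r ≤ (Finset.univ.filter fun i : Fin m => p i ≤ α * r / m).card).sup id

/-- The rejection set `{i : p_i ≤ α k̂ / m}` of the Benjamini-Hochberg procedure at level `α`. -/
noncomputable def BH (α : ℝ) (p : Fin m → ℝ) : Finset (Fin m) :=
  Finset.univ.filter fun i => p i ≤ α * bhCount α p / m

/-- The `r`-th smallest of `p₁, …, p_m`, counted with multiplicity, for `1 ≤ r ≤ m`. -/
noncomputable def orderStat (p : Fin m → ℝ) (r : ℕ) (hr : 1 ≤ r ∧ r ≤ m) : ℝ :=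
  p (Tuple.sort p ⟨r - 1, by omega⟩)

/-- The Storey estimator `(1 + #{i : p_i ≥ lam}) / (m (1 - lam))`, for `0 < lam < 1`. -/
noncomputable def pi0Storey (lam : ℝ) (p : Fin m → ℝ) : ℝ≥0∞ :=
  (1 + ((Finset.univ.filter fun i : Fin m => lam ≤ p i).card : ℝ≥0∞)) /
    ((m : ℝ≥0∞) * ENNReal.ofReal (1 - lam))

/-- The quantile estimator `(m - k₀ + 1) / (m (1 - p_(k₀)))`, which is `∞` if `p_(k₀) = 1`. -/
noncomputable def pi0Quant (k₀ : ℕ) (hk₀ : 1 ≤ k₀ ∧ k₀ ≤ m) (p : Fin m → ℝ) : ℝ≥0∞ :=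
  ((m - k₀ + 1 : ℕ) : ℝ≥0∞) / ((m : ℝ≥0∞) * ENNReal.ofReal (1 - orderStat p k₀ hk₀))

/-- The level `α / π̂₀`, for `α ≥ 0` and an estimate `π̂₀ ∈ (0, ∞]`; it is `0` if `π̂₀ = ∞`. -/
noncomputable def adaptiveLevel (α : ℝ) (pi0 : ℝ≥0∞) : ℝ :=
  (ENNReal.ofReal α / pi0).toReal

variable {𝒵 : Type*} {k : ℕ}

/-- Storey-AdaDetect: the Benjamini-Hochberg procedure at level `α / π̂₀` on the empirical p-values,
with the Storey estimator. -/
noncomputable def storeyAdaDetect (g : 𝒵 → (Fin k → 𝒵) → (Fin ℓ ⊕ Fin m → 𝒵) → ℝ)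
    (α lam : ℝ) (z : Pos k ℓ m → 𝒵) : Finset (Fin m) :=
  BH (adaptiveLevel α (pi0Storey lam (empPValue (scores g z)))) (empPValue (scores g z))

/-- Quantile-AdaDetect: the Benjamini-Hochberg procedure at level `α / π̂₀` on the empirical
p-values, with the quantile estimator. -/
noncomputable def quantileAdaDetect (g : 𝒵 → (Fin k → 𝒵) → (Fin ℓ ⊕ Fin m → 𝒵) → ℝ)
    (α : ℝ) (k₀ : ℕ) (hk₀ : 1 ≤ k₀ ∧ k₀ ≤ m) (z : Pos k ℓ m → 𝒵) : Finset (Fin m) :=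
  BH (adaptiveLevel α (pi0Quant k₀ hk₀ (empPValue (scores g z)))) (empPValue (scores g z))

end Procedures

end AdaDetect

/-!
Fix a true null `j`. Exchanging position `j` of the test sample with the positions of the second
null sample gives `ℓ + 1` arrangements of the data, the present one included. By conditional
exchangeability they all have the same joint distribution, and by the symmetry of the score
function each of them merely exchanges two scores. Hence expectations may be replaced by averages
over these swaps, and what remains is a deterministic statement about a family of distinct scores.

Along the swaps, the `j`-th p-value runs through the grid `1 / (ℓ + 1), …, 1`
(`card_empPValue_swapped_le`), all other p-values are monotone functions of it
(`empPValue_swapped_mono`), and each of them takes at most two adjacent grid values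
(`empPValue_swapped_le_add`). For a level `L` that is antitone in the p-values, let `y` be the
swap with the largest `j`-th p-value `t` among those where `j` is rejected. Every other swap
rejecting `j` has at least as many rejections as `y`, so the contributions of `j` to the false
discovery proportion add up to at most `(ℓ + 1) t / k̂ ≤ (ℓ + 1) L / m`, with `k̂` and `L`
evaluated at `y` (`sum_rejWeight_BH_le`).

For both estimators, `(ℓ + 1) L / m` is at most `α` times the sum over the swaps of an e-value
`E j`, because, for every `t ≥ 0`, the `j`-th p-value exceeds `t` for at least `(ℓ + 1) (1 - t)` of
the swaps:

* for the Storey estimator, `E j = 1{p_j > λ} / #{i ∈ 𝓗₀ : p_i > λ}`;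
* for the quantile estimator, `E j` is `1 / (m - k₀ + 1)` if the score of `j` is not among the
  `k₀ - 1` largest test scores, and `0` otherwise.

In both cases the `E j` sum to at most `1` over the true nulls, pointwise, and taking expectations
bounds the false discovery rate by `α` (`controlsFDR_of_sum_swapped_le`). Procedures and e-values
depend on the scores only through their ordering, which settles measurability and integrability.
-/

namespace AdaDetect

/-! ### Invariance of the joint distribution under swaps of null observations -/

section Exchangeability

variable {𝒵 : Type*} [MeasurableSpace 𝒵]

/-- Conditional exchangeability of the coordinates in `N` makes the whole joint distribution
invariant under the permutations that fix every position outside `N`. -/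
theorem CondExchangeable.map_comp_perm {ι : Type*} {P : Measure (ι → 𝒵)} [IsProbabilityMeasure P]
    {N : Set ι} [DecidablePred (· ∈ N)] (h : CondExchangeable P N) (σ : Equiv.Perm N) :
    P.map (fun z i => z (Equiv.Perm.ofSubtype σ i)) = P := by
  have hmperm : Measurable fun (z : ι → 𝒵) i => z (Equiv.Perm.ofSubtype σ i) := by fun_prop
  -- A measure on `ι → 𝒵` is determined by its values on products of a measurable set of
  -- coordinates in `N` with one of coordinates outside `N`.
  let e := MeasurableEquiv.piEquivPiSubtypeProd (fun _ : ι => 𝒵) (· ∈ N)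
  have : IsProbabilityMeasure (P.map fun z i => z (Equiv.Perm.ofSubtype σ i)) :=
    Measure.isProbabilityMeasure_map hmperm.aemeasurable
  suffices hs : (P.map fun z i => z (Equiv.Perm.ofSubtype σ i)).map e = P.map e from
    (MeasurableEquiv.map_measurableEquiv_injective e) hs
  rw [Measure.map_map e.measurable hmperm]
  have : IsFiniteMeasure (P.map (e ∘ fun z i => z (Equiv.Perm.ofSubtype σ i))) :=
    Measure.isFiniteMeasure_map _ _
  refine Measure.ext_prod fun {A B} hA hB => ?_
  rw [Measure.map_apply (e.measurable.comp hmperm) (hA.prod hB),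
    Measure.map_apply e.measurable (hA.prod hB)]
  have hle : MeasurableSpace.comap (fun (z : ι → 𝒵) (i : (Nᶜ : Set ι)) => z i) inferInstance
      ≤ (inferInstance : MeasurableSpace (ι → 𝒵)) := by
    refine Measurable.comap_le ?_
    fun_prop
  have hB' : MeasurableSet[MeasurableSpace.comap
      (fun (z : ι → 𝒵) (i : (Nᶜ : Set ι)) => z i) inferInstance]
      {z : ι → 𝒵 | (fun i : (Nᶜ : Set ι) => z i) ∈ B} := ⟨B, hB, rfl⟩
  have hA₁ : MeasurableSet {z : ι → 𝒵 | (fun i : N => z (σ i)) ∈ A} := by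
    refine measurableSet_preimage (f := fun (z : ι → 𝒵) (i : N) => z (σ i)) ?_ hA
    fun_prop
  have hA₂ : MeasurableSet {z : ι → 𝒵 | (fun i : N => z i) ∈ A} := by
    refine measurableSet_preimage (f := fun (z : ι → 𝒵) (i : N) => z i) ?_ hA
    fun_prop
  have key : ∀ {E : Set (ι → 𝒵)}, MeasurableSet E →
      ∫ z in {z : ι → 𝒵 | (fun i : (Nᶜ : Set ι) => z i) ∈ B},
        (P⟦E | MeasurableSpace.comap
          (fun (z : ι → 𝒵) (i : (Nᶜ : Set ι)) => z i) inferInstance⟧) z ∂P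
      = P.real (E ∩ {z : ι → 𝒵 | (fun i : (Nᶜ : Set ι) => z i) ∈ B}) := by
    intro E hE
    rw [setIntegral_condExp hle ((integrable_const _).indicator hE) hB',
      integral_indicator hE, Measure.restrict_restrict hE]
    simp
  have heq := (key hA₁).symm.trans
    ((setIntegral_congr_ae (hle _ hB') ((h σ A hA).mono fun z hz _ => hz)).trans (key hA₂))
  rw [measureReal_def, measureReal_def,
    ENNReal.toReal_eq_toReal_iff' (measure_ne_top _ _) (measure_ne_top _ _)] at heq
  suffices hpre : (e ∘ fun z i => z (Equiv.Perm.ofSubtype σ i)) ⁻¹' A ×ˢ B =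
      {z : ι → 𝒵 | (fun i : N => z (σ i)) ∈ A} ∩
        {z : ι → 𝒵 | (fun i : (Nᶜ : Set ι) => z i) ∈ B} from (congrArg P hpre).trans heq
  ext z
  have h₁ : ∀ i : N, Equiv.Perm.ofSubtype σ (i : ι) = σ i :=
    fun i => Equiv.Perm.ofSubtype_apply_coe σ i
  have h₂ : ∀ i : (Nᶜ : Set ι), Equiv.Perm.ofSubtype σ (i : ι) = i :=
    fun i => Equiv.Perm.ofSubtype_apply_of_not_mem σ i.2
  have e₁ : (e fun i => z (Equiv.Perm.ofSubtype σ i)).1 = fun i : N => z (σ i) :=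
    funext fun i => congrArg z (h₁ i)
  have e₂ : (e fun i => z (Equiv.Perm.ofSubtype σ i)).2 = fun i : (Nᶜ : Set ι) => z i :=
    funext fun i => congrArg z (h₂ i)
  change _ ∈ A ∧ _ ∈ B ↔ _ ∈ A ∧ _ ∈ B
  rw [Function.comp_apply, e₁, e₂]

theorem CondExchangeable.map_comp_swap {ι : Type*} [DecidableEq ι] {P : Measure (ι → 𝒵)}
    [IsProbabilityMeasure P] {N : Set ι} (h : CondExchangeable P N) {a b : ι} (ha : a ∈ N)
    (hb : b ∈ N) : P.map (fun z i => z (Equiv.swap a b i)) = P := by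
  classical
  have := h.map_comp_perm (Equiv.swap ⟨a, ha⟩ ⟨b, hb⟩)
  rwa [Equiv.Perm.ofSubtype_swap_eq] at this

variable {k ℓ m : ℕ}

/-- Swapping two positions `a`, `b` of the second null sample and the test sample swaps the
corresponding scores, as the score function is symmetric in these observations. -/
theorem IsScoreFunction.scores_comp_swap {g : 𝒵 → (Fin k → 𝒵) → (Fin ℓ ⊕ Fin m → 𝒵) → ℝ}
    (hg : IsScoreFunction g) (a b : Fin ℓ ⊕ Fin m) (z : Pos k ℓ m → 𝒵) :
    scores g (fun i => z (Equiv.swap (Sum.inr a) (Sum.inr b) i)) =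
      scores g z ∘ Equiv.swap a b := by
  have hr : ∀ i : Fin ℓ ⊕ Fin m, Equiv.swap (Sum.inr a) (Sum.inr b) (Sum.inr i : Pos k ℓ m) =
      Sum.inr (Equiv.swap a b i) := fun i => (Sum.inr_injective.map_swap a b i).symm
  have hl : ∀ i : Fin k, Equiv.swap (Sum.inr a) (Sum.inr b) (Sum.inl i : Pos k ℓ m) =
      Sum.inl i := fun i => Equiv.swap_apply_of_ne_of_ne (by simp) (by simp)
  funext i
  simp only [scores, hr, hl, Function.comp_apply]
  exact hg.invariant (Equiv.swap a b) _ _ fun b => z (Sum.inr b)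

theorem IsScoreFunction.measurable_scores
    {g : 𝒵 → (Fin k → 𝒵) → (Fin ℓ ⊕ Fin m → 𝒵) → ℝ} (hg : IsScoreFunction g) :
    Measurable (scores (k := k) g) := by
  refine measurable_pi_lambda _ fun i => ?_
  have : Measurable fun z : Pos k ℓ m → 𝒵 =>
      (z (Sum.inr i), (fun a => z (Sum.inl a)), fun b => z (Sum.inr b)) := by fun_prop
  exact hg.measurable.comp this

end Exchangeability

/-! ### Functions of the ordering of the scores -/

section Order

variable {ι : Type*} {β : Type*}

/-- `f S` depends on the real family `S` only through the relation `S a < S b`. -/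
def OrderDetermined (f : (ι → ℝ) → β) : Prop :=
  ∀ S T : ι → ℝ, (∀ a b, S a < S b ↔ T a < T b) → f S = f T

/-- The comparison table of a real family. -/
noncomputable def orderTable (S : ι → ℝ) (q : ι × ι) : Bool :=
  open Classical in decide (S q.1 < S q.2)

theorem measurable_orderTable : Measurable (orderTable (ι := ι)) := by
  refine measurable_pi_lambda _ fun q => measurable_to_bool ?_
  have : (fun S : ι → ℝ => orderTable S q) ⁻¹' {true} = {S | S q.1 < S q.2} := by
    ext S; simp [orderTable]
  rw [this]
  exact measurableSet_lt (measurable_pi_apply _) (measurable_pi_apply _)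

theorem OrderDetermined.exists_eq_comp [Nonempty β] {f : (ι → ℝ) → β} (hf : OrderDetermined f) :
    ∃ F : (ι × ι → Bool) → β, f = F ∘ orderTable := by
  have h : Function.FactorsThrough f (orderTable (ι := ι)) := by
    intro S T h
    refine hf S T fun a b => ?_
    simpa [orderTable] using congrFun h (a, b)
  exact (Function.factorsThrough_iff f).1 h

theorem OrderDetermined.comp {γ : Type*} {f : (ι → ℝ) → β} (hf : OrderDetermined f) (F : β → γ) :
    OrderDetermined fun S => F (f S) :=
  fun S T h => congrArg F (hf S T h)

variable [Finite ι]

theorem OrderDetermined.measurable [MeasurableSpace β] [Nonempty β] {f : (ι → ℝ) → β}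
    (hf : OrderDetermined f) : Measurable f := by
  obtain ⟨F, rfl⟩ := hf.exists_eq_comp
  exact (measurable_of_countable F).comp measurable_orderTable

/-- Only finitely many orderings exist, so functions of the ordering are bounded. -/
theorem OrderDetermined.integrable_comp {Ω : Type*} [MeasurableSpace Ω] {P : Measure Ω}
    [IsFiniteMeasure P] {f : (ι → ℝ) → ℝ} (hf : OrderDetermined f) {X : Ω → ι → ℝ}
    (hX : Measurable X) : Integrable (fun z => f (X z)) P := by
  obtain ⟨F, rfl⟩ := hf.exists_eq_comp
  exact (Integrable.of_finite (f := F)).comp_measurable (measurable_orderTable.comp hX)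

end Order

/-! ### From sums over swaps to the false discovery rate -/

section Swaps

variable {ℓ m : ℕ}

/-- The `ℓ + 1` positions made of the second null sample and the test position `j`, the latter
being the image of `none`. -/
def calib (j : Fin m) : Option (Fin ℓ) → Fin ℓ ⊕ Fin m
  | none => Sum.inr j
  | some c => Sum.inl c

theorem calib_injective (j : Fin m) : Function.Injective (calib (ℓ := ℓ) j) := by
  rintro (_ | a) (_ | b) h <;> simp_all [calib]

/-- The scores with the entries at the positions `calib j x` and `j` exchanged. -/
def swapped (S : Fin ℓ ⊕ Fin m → ℝ) (j : Fin m) (x : Option (Fin ℓ)) : Fin ℓ ⊕ Fin m → ℝ :=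
  S ∘ Equiv.swap (calib j x) (Sum.inr j)

/-- The contribution of the index `j` to the false discovery proportion of `R`. -/
noncomputable def rejWeight (R : Finset (Fin m)) (j : Fin m) : ℝ :=
  if j ∈ R then 1 / ((max 1 R.card : ℕ) : ℝ) else 0

theorem FDP_eq_sum (H : Set (Fin m)) [DecidablePred (· ∈ H)] (R : Finset (Fin m)) :
    FDP H R = ∑ j with j ∈ H, rejWeight R j := by
  have : (R.filter (· ∈ H)) = (Finset.univ.filter (· ∈ H)).filter (· ∈ R) := by
    ext; simp [and_comm]
  unfold FDP rejWeight
  rw [← Finset.sum_filter, Finset.sum_const, nsmul_eq_mul, ← this, mul_one_div]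
  congr!

variable {𝒵 : Type*} [MeasurableSpace 𝒵] {k : ℕ}

theorem integral_swapped {P : Measure (Pos k ℓ m → 𝒵)} [IsProbabilityMeasure P] {P₀ : Measure 𝒵}
    (hexch : CondExchangeable P (nullPositions k ℓ (trueNulls P P₀)))
    {g : 𝒵 → (Fin k → 𝒵) → (Fin ℓ ⊕ Fin m → 𝒵) → ℝ} (hg : IsScoreFunction g)
    {f : (Fin ℓ ⊕ Fin m → ℝ) → ℝ} (hf : OrderDetermined f) {j : Fin m}
    (hj : j ∈ trueNulls P P₀) (x : Option (Fin ℓ)) :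
    ∫ z, f (swapped (scores g z) j x) ∂P = ∫ z, f (scores g z) ∂P := by
  have hx : Sum.inr (calib j x) ∈ nullPositions k ℓ (trueNulls P P₀) := by
    intro i hi
    cases x <;> simp_all [calib]
  have hj' : Sum.inr (Sum.inr j) ∈ nullPositions k ℓ (trueNulls P P₀) := by
    intro i hi
    simp_all
  have hmap := hexch.map_comp_swap hx hj'
  have hmeas : Measurable fun (z : Pos k ℓ m → 𝒵) i =>
      z (Equiv.swap (Sum.inr (calib j x)) (Sum.inr (Sum.inr j)) i) := by fun_prop
  have hint := integral_map (μ := P) (f := fun z => f (scores g z)) hmeas.aemeasurable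
    (hf.measurable.comp hg.measurable_scores).aestronglyMeasurable
  simp only [hmap, hg.scores_comp_swap] at hint
  exact hint.symm

/-- If, for each true null `j`, the contribution of `j` to the false discovery proportion is
bounded by `α * E j` after summation over the `ℓ + 1` swaps of position `j`, and if the `E j` sum
to at most `1` over the true nulls, then the procedure controls the false discovery rate at
level `α`. The swaps preserve the joint distribution, so the `E j` act as e-values. -/
theorem controlsFDR_of_sum_swapped_le {P : Measure (Pos k ℓ m → 𝒵)} [IsProbabilityMeasure P]
    {P₀ : Measure 𝒵} (hexch : CondExchangeable P (nullPositions k ℓ (trueNulls P P₀)))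
    {g : 𝒵 → (Fin k → 𝒵) → (Fin ℓ ⊕ Fin m → 𝒵) → ℝ} (hg : IsScoreFunction g)
    (hties : NoTies P g) {α : ℝ} (hα : 0 ≤ α)
    {R : (Fin ℓ ⊕ Fin m → ℝ) → Finset (Fin m)} (hR : OrderDetermined R)
    {E : Fin m → (Fin ℓ ⊕ Fin m → ℝ) → ℝ} (hE : ∀ j, OrderDetermined (E j))
    (hswap : ∀ S, Function.Injective S → ∀ j ∈ trueNulls P P₀,
      ∑ x, rejWeight (R (swapped S j x)) j ≤ α * ∑ x, E j (swapped S j x))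
    [DecidablePred (· ∈ trueNulls P P₀)]
    (hsum : ∀ S, Function.Injective S → ∑ j with j ∈ trueNulls P P₀, E j S ≤ 1) :
    ControlsFDR P P₀ (fun z => R (scores g z)) α := by
  have hRw : ∀ j, OrderDetermined fun S => rejWeight (R S) j := fun j => hR.comp (rejWeight · j)
  have hswapped : ∀ {f : (Fin ℓ ⊕ Fin m → ℝ) → ℝ}, OrderDetermined f → ∀ j x,
      OrderDetermined fun S => f (swapped S j x) :=
    fun hf j x S T h => hf _ _ fun a b => h _ _
  have hint : ∀ {f : (Fin ℓ ⊕ Fin m → ℝ) → ℝ}, OrderDetermined f →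
      Integrable (fun z => f (scores g z)) P := fun hf => hf.integrable_comp hg.measurable_scores
  refine ⟨fun j => ?_, ?_⟩
  · have hj : Measurable fun S => j ∈ R S := (hR.comp (j ∈ ·)).measurable
    exact (hj.comp hg.measurable_scores).setOf
  have hj : ∀ j ∈ trueNulls P P₀,
      ∫ z, rejWeight (R (scores g z)) j ∂P ≤ α * ∫ z, E j (scores g z) ∂P := by
    intro j hj
    have havg : ∀ {f : (Fin ℓ ⊕ Fin m → ℝ) → ℝ}, OrderDetermined f →
        ∫ z, ∑ x, f (swapped (scores g z) j x) ∂P = (ℓ + 1) * ∫ z, f (scores g z) ∂P := by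
      intro f hf
      rw [integral_finsetSum _ fun x _ => hint (hswapped hf j x)]
      simp [integral_swapped hexch hg hf hj]
    have hle : ∫ z, ∑ x, rejWeight (R (swapped (scores g z) j x)) j ∂P ≤
        ∫ z, α * ∑ x, E j (swapped (scores g z) j x) ∂P := by
      refine integral_mono_ae (integrable_finsetSum _ fun x _ => hint (hswapped (hRw j) j x))
        ((integrable_finsetSum _ fun x _ => hint (hswapped (hE j) j x)).const_mul α) ?_
      filter_upwards [hties] with z hz using hswap _ hz j hj
    rw [integral_const_mul, havg (hRw j), havg (hE j), mul_left_comm] at hle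
    exact le_of_mul_le_mul_left hle (by positivity)
  calc FDR P P₀ (fun z => R (scores g z))
      = ∑ j with j ∈ trueNulls P P₀, ∫ z, rejWeight (R (scores g z)) j ∂P := by
        simp only [FDR, FDP_eq_sum]
        exact integral_finsetSum _ fun j _ => hint (hRw j)
    _ ≤ ∑ j with j ∈ trueNulls P P₀, α * ∫ z, E j (scores g z) ∂P :=
        Finset.sum_le_sum fun j h => hj j (by simpa using h)
    _ = α * ∫ z, ∑ j with j ∈ trueNulls P P₀, E j (scores g z) ∂P := by
        rw [← Finset.mul_sum, integral_finsetSum _ fun j _ => hint (hE j)]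
    _ ≤ α * ∫ _, 1 ∂P := by
        refine mul_le_mul_of_nonneg_left (integral_mono_ae
          (integrable_finsetSum _ fun j _ => hint (hE j)) (integrable_const _) ?_) hα
        filter_upwards [hties] with z hz using hsum _ hz
    _ = α := by simp

end Swaps

/-! ### The p-values along the swaps of a test position -/

section PValues

variable {ℓ m : ℕ}

theorem orderDetermined_empPValue : OrderDetermined (empPValue (ℓ := ℓ) (m := m)) := by
  intro S T h
  funext j
  simp only [empPValue, gt_iff_lt, h]

theorem empPValue_pos (S : Fin ℓ ⊕ Fin m → ℝ) (j : Fin m) : 0 < empPValue S j := by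
  unfold empPValue; positivity

@[simp]
theorem swapped_inr_self (S : Fin ℓ ⊕ Fin m → ℝ) (j : Fin m) (x : Option (Fin ℓ)) :
    swapped S j x (Sum.inr j) = S (calib j x) := by
  simp [swapped]

theorem swapped_inr_of_ne (S : Fin ℓ ⊕ Fin m → ℝ) {i j : Fin m} (h : i ≠ j)
    (x : Option (Fin ℓ)) : swapped S j x (Sum.inr i) = S (Sum.inr i) := by
  unfold swapped
  rw [Function.comp_apply, Equiv.swap_apply_of_ne_of_ne _ (by simpa using h)]
  cases x <;> simp [calib, h]

/-- The number of scores above `t` among the second null sample and the test position `j`. It does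
not change when these positions are permuted. -/
noncomputable def calibCount (S : Fin ℓ ⊕ Fin m → ℝ) (j : Fin m) (t : ℝ) : ℕ :=
  (Finset.univ.filter fun y => t < S (calib j y)).card

theorem card_swapped_add (S : Fin ℓ ⊕ Fin m → ℝ) (j : Fin m) (x : Option (Fin ℓ)) (t : ℝ) :
    (Finset.univ.filter fun c : Fin ℓ => swapped S j x (Sum.inl c) > t).card +
      (if t < S (calib j x) then 1 else 0) = calibCount S j t := by
  have h : ∀ y, swapped S j x (calib j y) = S (calib j (Equiv.swap x none y)) := fun y =>
    congrArg S ((calib_injective j).map_swap x none y).symm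
  have hsum : ∑ y, (if t < swapped S j x (calib j y) then 1 else 0) = calibCount S j t := by
    simp only [h, calibCount, Finset.card_filter]
    exact Equiv.sum_comp (Equiv.swap x none) fun y => if t < S (calib j y) then 1 else 0
  rw [← hsum, Fintype.sum_option, Finset.card_filter, add_comm]
  change _ = (if t < swapped S j x (Sum.inr j) then 1 else 0) + _
  rw [swapped_inr_self]
  rfl

theorem empPValue_swapped_self (S : Fin ℓ ⊕ Fin m → ℝ) (j : Fin m) (x : Option (Fin ℓ)) :
    empPValue (swapped S j x) j = (1 + (calibCount S j (S (calib j x)) : ℝ)) / (ℓ + 1) := by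
  rw [← card_swapped_add S j x]
  simp [empPValue]

theorem empPValue_swapped_of_ne (S : Fin ℓ ⊕ Fin m → ℝ) {i j : Fin m} (h : i ≠ j)
    (x : Option (Fin ℓ)) :
    empPValue (swapped S j x) i = (1 + (calibCount S j (S (Sum.inr i)) : ℝ) -
      (if S (Sum.inr i) < S (calib j x) then 1 else 0)) / (ℓ + 1) := by
  rw [← card_swapped_add S j x]
  simp only [empPValue, swapped_inr_of_ne S h]
  push_cast
  ring

theorem calibCount_lt {S : Fin ℓ ⊕ Fin m → ℝ} {j : Fin m} {x : Option (Fin ℓ)} {s : ℝ}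
    (h : s < S (calib j x)) : calibCount S j (S (calib j x)) < calibCount S j s := by
  refine Finset.card_lt_card ⟨fun y hy => ?_, fun hsub => ?_⟩
  · simp only [Finset.mem_filter, Finset.mem_univ, true_and] at hy ⊢
    exact h.trans hy
  · simpa using hsub (Finset.mem_filter.2 ⟨Finset.mem_univ x, h⟩)

theorem card_lt_injective {ι : Type*} [Fintype ι] {a : ι → ℝ} (ha : Function.Injective a) :
    Function.Injective fun x => (Finset.univ.filter fun y => a x < a y).card := by
  have hlt : ∀ x y, a x < a y → (Finset.univ.filter fun z => a y < a z).card <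
      (Finset.univ.filter fun z => a x < a z).card := by
    intro x y h
    refine Finset.card_lt_card ⟨fun z hz => ?_, fun hsub => ?_⟩
    · simp only [Finset.mem_filter, Finset.mem_univ, true_and] at hz ⊢
      exact h.trans hz
    · simpa using hsub (Finset.mem_filter.2 ⟨Finset.mem_univ y, h⟩)
  intro x y hxy
  dsimp only at hxy
  refine ha (le_antisymm ?_ ?_) <;> by_contra! hc <;> have := hlt _ _ hc <;> omega

/-- The number of indices with fewer than `M` larger values is at most `M`. -/
theorem card_filter_card_lt_le {ι : Type*} [Fintype ι] {a : ι → ℝ} (ha : Function.Injective a)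
    (M : ℕ) :
    (Finset.univ.filter fun x => (Finset.univ.filter fun y => a x < a y).card < M).card ≤ M := by
  conv_rhs => rw [← Finset.card_range M]
  exact Finset.card_le_card_of_injOn _ (fun x hx => by simpa using hx)
    (card_lt_injective ha).injOn

/-- The number of indices with at least `M` larger values is at most `card ι - M`. -/
theorem card_filter_le_card_lt_le {ι : Type*} [Fintype ι] {a : ι → ℝ} (ha : Function.Injective a)
    (M : ℕ) :
    (Finset.univ.filter fun x => M ≤ (Finset.univ.filter fun y => a x < a y).card).card ≤
      Fintype.card ι - M := by
  rw [← Nat.card_Ico]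
  refine Finset.card_le_card_of_injOn _ (fun x hx => ?_) (card_lt_injective ha).injOn
  have hx' : (Finset.univ.filter fun y => a x < a y).card < Fintype.card ι :=
    Finset.card_lt_univ_of_notMem (x := x) (by simp)
  simp only [Finset.coe_filter, Finset.mem_univ, true_and, Set.mem_ofPred_eq] at hx
  simpa using ⟨hx, hx'⟩

/-- Along the swaps of position `j`, the `j`-th p-value is superuniform. -/
theorem card_empPValue_swapped_le {S : Fin ℓ ⊕ Fin m → ℝ} (hS : Function.Injective S) (j : Fin m)
    {t : ℝ} (ht : 0 ≤ t) :
    ((Finset.univ.filter fun x => empPValue (swapped S j x) j ≤ t).card : ℝ) ≤ (ℓ + 1) * t := by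
  have hle := card_filter_card_lt_le (hS.comp (calib_injective j)) ⌊((ℓ : ℝ) + 1) * t⌋₊
  have hfloor : (⌊((ℓ : ℝ) + 1) * t⌋₊ : ℝ) ≤ (ℓ + 1) * t := Nat.floor_le (by positivity)
  refine le_trans ?_ hfloor
  refine Nat.cast_le.2 (le_trans (Finset.card_le_card fun x hx => ?_) hle)
  simp only [Finset.mem_filter, Finset.mem_univ, true_and] at hx ⊢
  rw [empPValue_swapped_self, div_le_iff₀ (by positivity)] at hx
  refine Nat.lt_of_succ_le (Nat.le_floor ?_)
  unfold calibCount at hx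
  push_cast
  simp only [Function.comp_apply]
  linarith

theorem le_card_lt_empPValue_swapped {S : Fin ℓ ⊕ Fin m → ℝ} (hS : Function.Injective S)
    (j : Fin m) {t : ℝ} (ht : 0 ≤ t) :
    (ℓ + 1) * (1 - t) ≤
      ((Finset.univ.filter fun x => t < empPValue (swapped S j x) j).card : ℝ) := by
  have h₁ := card_empPValue_swapped_le hS j ht
  have h₂ := Finset.card_filter_add_card_filter_not (s := Finset.univ)
    fun x : Option (Fin ℓ) => empPValue (swapped S j x) j ≤ t
  simp only [not_le, Finset.card_univ, Fintype.card_option, Fintype.card_fin] at h₂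
  have h₃ : (((Finset.univ.filter fun x => empPValue (swapped S j x) j ≤ t).card : ℝ)) +
      ((Finset.univ.filter fun x => t < empPValue (swapped S j x) j).card : ℝ) = ℓ + 1 := by
    exact_mod_cast h₂
  linarith

/-- Along the swaps of position `j`, all p-values are monotone functions of the `j`-th one. -/
theorem empPValue_swapped_mono (S : Fin ℓ ⊕ Fin m → ℝ) {j : Fin m} {x y : Option (Fin ℓ)}
    (h : empPValue (swapped S j x) j ≤ empPValue (swapped S j y) j) :
    empPValue (swapped S j x) ≤ empPValue (swapped S j y) := by
  intro i
  rcases eq_or_ne i j with rfl | hi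
  · exact h
  have hxy : S (calib j y) ≤ S (calib j x) := by
    by_contra! hc
    have hlt : (calibCount S j (S (calib j y)) : ℝ) < calibCount S j (S (calib j x)) := by
      exact_mod_cast calibCount_lt hc
    rw [empPValue_swapped_self, empPValue_swapped_self, div_le_div_iff_of_pos_right
      (by positivity)] at h
    linarith
  rw [empPValue_swapped_of_ne S hi, empPValue_swapped_of_ne S hi]
  gcongr
  split_ifs with h₁ h₂ <;> first | exact absurd (h₁.trans_le hxy) h₂ | norm_num

/-- The swaps of position `j` move the other p-values by at most one grid step. -/
theorem empPValue_swapped_le_add (S : Fin ℓ ⊕ Fin m → ℝ) {i j : Fin m} (h : i ≠ j)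
    (x y : Option (Fin ℓ)) :
    empPValue (swapped S j x) i ≤ empPValue (swapped S j y) i + 1 / (ℓ + 1) := by
  rw [empPValue_swapped_of_ne S h, empPValue_swapped_of_ne S h, ← add_div]
  gcongr
  split_ifs <;> linarith

/-- A test position whose p-value is below the `j`-th one, even if the two are taken along different
swaps of position `j`, has a larger score than position `j`. -/
theorem lt_of_empPValue_swapped_lt {S : Fin ℓ ⊕ Fin m → ℝ} (hS : Function.Injective S)
    {i j : Fin m} (hij : i ≠ j) {x y : Option (Fin ℓ)}
    (h : empPValue (swapped S j y) i < empPValue (swapped S j x) j) :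
    S (calib j x) < S (Sum.inr i) := by
  by_contra! hle
  have hne : S (Sum.inr i) ≠ S (calib j x) := fun he => by
    have := hS he
    cases x <;> simp_all [calib]
  have hlt : (calibCount S j (S (calib j x)) : ℝ) + 1 ≤ calibCount S j (S (Sum.inr i)) := by
    exact_mod_cast calibCount_lt (lt_of_le_of_ne hle hne)
  rw [empPValue_swapped_self, empPValue_swapped_of_ne S hij,
    div_lt_div_iff_of_pos_right (by positivity)] at h
  split_ifs at h <;> linarith

end PValues

/-! ### The Benjamini-Hochberg procedure at an antitone level -/

section BH

variable {ℓ m : ℕ}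

theorem bhCount_le_card_BH (a : ℝ) (p : Fin m → ℝ) : bhCount a p ≤ (BH a p).card := by
  obtain ⟨r, hr, he⟩ := Finset.exists_mem_eq_sup ((Finset.range (m + 1)).filter fun r : ℕ =>
    r ≤ (Finset.univ.filter fun i : Fin m => p i ≤ a * r / m).card) ⟨0, by simp⟩ id
  have he' : bhCount a p = r := he
  unfold BH
  rw [he']
  exact (Finset.mem_filter.1 hr).2

theorem bhCount_mono {a b : ℝ} {p q : Fin m → ℝ} (hab : a ≤ b) (hqp : q ≤ p) :
    bhCount a p ≤ bhCount b q := by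
  refine Finset.sup_mono fun r hr => ?_
  simp only [Finset.mem_filter] at hr ⊢
  refine ⟨hr.1, hr.2.trans (Finset.card_le_card fun i hi => ?_)⟩
  simp only [Finset.mem_filter, Finset.mem_univ, true_and] at hi ⊢
  exact (hqp i).trans (hi.trans (by gcongr))

/-- Total contribution of a test position `j` to the false discovery proportion along its swaps,
when the level `L` of the procedure is antitone in the p-values. Let `y` be the swap with the
largest `j`-th p-value among those where `j` is rejected. The other swaps rejecting `j` have smaller
p-values, hence at least as many rejections, and superuniformity bounds their number. -/
theorem sum_rejWeight_BH_le {S : Fin ℓ ⊕ Fin m → ℝ} (hS : Function.Injective S) (j : Fin m)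
    {L : (Fin m → ℝ) → ℝ} (hL : Antitone L) {B : ℝ} (hB₀ : 0 ≤ B)
    (hB : ∀ y, (ℓ + 1) * (L (empPValue (swapped S j y)) / m) ≤ B) :
    ∑ x, rejWeight (BH (L (empPValue (swapped S j x))) (empPValue (swapped S j x))) j ≤ B := by
  set p : Option (Fin ℓ) → Fin m → ℝ := fun x => empPValue (swapped S j x) with hp
  unfold rejWeight
  rw [← Finset.sum_filter]
  rcases (Finset.univ.filter fun x => j ∈ BH (L (p x)) (p x)).eq_empty_or_nonempty with he | hne
  · rw [he]; simpa
  obtain ⟨y, hy, hmax⟩ := Finset.exists_max_image _ (fun x => p x j) hne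
  simp only [Finset.mem_filter, Finset.mem_univ, true_and] at hy hmax
  have hyj : p y j ≤ L (p y) * bhCount (L (p y)) (p y) / m := by simpa [BH] using hy
  have hpos : 0 < p y j := empPValue_pos _ _
  have hk : 0 < (bhCount (L (p y)) (p y) : ℝ) := by
    rcases Nat.eq_zero_or_pos (bhCount (L (p y)) (p y)) with h0 | h0
    · rw [h0] at hyj
      simp only [Nat.cast_zero, mul_zero, zero_div] at hyj
      linarith
    · exact_mod_cast h0
  calc ∑ x with j ∈ BH (L (p x)) (p x), 1 / ((max 1 (BH (L (p x)) (p x)).card : ℕ) : ℝ)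
      ≤ ∑ x with j ∈ BH (L (p x)) (p x), 1 / (bhCount (L (p y)) (p y) : ℝ) := by
        refine Finset.sum_le_sum fun x hx => one_div_le_one_div_of_le hk ?_
        have hle : p x ≤ p y := empPValue_swapped_mono S (hmax x (by simpa using hx))
        exact_mod_cast (bhCount_mono (hL hle) hle).trans
          ((bhCount_le_card_BH _ _).trans (le_max_right _ _))
    _ ≤ ∑ x with p x j ≤ p y j, 1 / (bhCount (L (p y)) (p y) : ℝ) := by
        refine Finset.sum_le_sum_of_subset_of_nonneg (fun x hx => ?_) fun _ _ _ => by positivity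
        simpa using hmax x (by simpa using hx)
    _ ≤ (ℓ + 1) * p y j * (1 / (bhCount (L (p y)) (p y) : ℝ)) := by
        rw [Finset.sum_const, nsmul_eq_mul]
        gcongr
        exact card_empPValue_swapped_le hS j hpos.le
    _ ≤ (ℓ + 1) * (L (p y) * bhCount (L (p y)) (p y) / m) *
          (1 / (bhCount (L (p y)) (p y) : ℝ)) := by gcongr
    _ = (ℓ + 1) * (L (p y) / m) := by field_simp
    _ ≤ B := hB y

end BH

/-! ### The Storey estimator -/

section Storey

variable {ℓ m : ℕ}

theorem adaptiveLevel_pi0Storey {α lam : ℝ} (hα : 0 ≤ α) (hlam : lam ≤ 1) (p : Fin m → ℝ) :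
    adaptiveLevel α (pi0Storey lam p) =
      α * (m * (1 - lam)) / (1 + (Finset.univ.filter fun i => lam ≤ p i).card) := by
  rw [adaptiveLevel, pi0Storey, ENNReal.toReal_div, ENNReal.toReal_div, ENNReal.toReal_mul,
    ENNReal.toReal_ofReal hα, ENNReal.toReal_ofReal (sub_nonneg.2 hlam),
    ENNReal.toReal_add (by simp) (by simp), div_div_eq_mul_div]
  simp

theorem antitone_adaptiveLevel_pi0Storey {α lam : ℝ} (hα : 0 ≤ α) (hlam : lam ≤ 1) :
    Antitone fun p : Fin m → ℝ => adaptiveLevel α (pi0Storey lam p) := by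
  intro p q hpq
  simp only [adaptiveLevel_pi0Storey hα hlam]
  have : 0 ≤ 1 - lam := sub_nonneg.2 hlam
  gcongr with i
  exact hpq i

/-- The e-value of `j` for the Storey estimator, `H` being the set of true nulls: equal shares for
the indices of `H` with p-value above `lam`, and `0` for the other ones. -/
noncomputable def storeyEValue (H : Finset (Fin m)) (lam : ℝ) (j : Fin m)
    (S : Fin ℓ ⊕ Fin m → ℝ) : ℝ :=
  if lam < empPValue S j then 1 / ((H.filter fun i => lam < empPValue S i).card : ℝ) else 0

theorem orderDetermined_storeyEValue (H : Finset (Fin m)) (lam : ℝ) (j : Fin m) :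
    OrderDetermined (storeyEValue (ℓ := ℓ) H lam j) :=
  orderDetermined_empPValue.comp fun p =>
    if lam < p j then 1 / ((H.filter fun i => lam < p i).card : ℝ) else 0

theorem sum_storeyEValue_le_one (H : Finset (Fin m)) (lam : ℝ) (S : Fin ℓ ⊕ Fin m → ℝ) :
    ∑ j ∈ H, storeyEValue H lam j S ≤ 1 := by
  unfold storeyEValue
  rw [← Finset.sum_filter, Finset.sum_const, nsmul_eq_mul, mul_one_div]
  exact div_self_le_one _

/-- As `lam` lies on the grid of the p-values and a swap of position `j` moves the other p-values by
at most one grid step, those above `lam` after one swap are at least `lam` after any other. -/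
theorem card_lt_empPValue_swapped_le (H : Finset (Fin m)) (K : ℕ) (S : Fin ℓ ⊕ Fin m → ℝ)
    (j : Fin m) (x y : Option (Fin ℓ)) :
    (H.filter fun i => (K : ℝ) / (ℓ + 1) < empPValue (swapped S j x) i).card ≤
      1 + (Finset.univ.filter fun i => (K : ℝ) / (ℓ + 1) ≤ empPValue (swapped S j y) i).card := by
  rw [add_comm 1]
  refine le_trans (Finset.card_le_card fun i hi => ?_) (Finset.card_insert_le j _)
  rw [Finset.mem_insert]
  refine or_iff_not_imp_left.2 fun hij => ?_
  simp only [Finset.mem_filter, Finset.mem_univ, true_and] at hi ⊢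
  have hgrid : ((K : ℝ) + 1) / (ℓ + 1) ≤ empPValue (swapped S j x) i := by
    have := hi.2
    unfold empPValue at this ⊢
    rw [div_lt_div_iff_of_pos_right (by positivity)] at this
    rw [div_le_div_iff_of_pos_right (by positivity)]
    exact_mod_cast Nat.succ_le_of_lt (by exact_mod_cast this)
  have := empPValue_swapped_le_add S hij x y
  rw [add_div] at hgrid
  linarith

theorem storey_sum_swapped_le {S : Fin ℓ ⊕ Fin m → ℝ} (hS : Function.Injective S)
    {H : Finset (Fin m)} {j : Fin m} (hj : j ∈ H) {α : ℝ} (hα : 0 ≤ α) {K : ℕ} (hK : K ≤ ℓ) :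
    ∑ x, rejWeight (BH (adaptiveLevel α (pi0Storey ((K : ℝ) / (ℓ + 1))
        (empPValue (swapped S j x)))) (empPValue (swapped S j x))) j ≤
      α * ∑ x, storeyEValue H ((K : ℝ) / (ℓ + 1)) j (swapped S j x) := by
  have hm : (m : ℝ) ≠ 0 := Nat.cast_ne_zero.2 (Fin.pos j).ne'
  have hlam : (K : ℝ) / (ℓ + 1) ≤ 1 := by
    rw [div_le_one (by positivity)]
    exact_mod_cast hK.trans ℓ.le_succ
  set lam : ℝ := (K : ℝ) / (ℓ + 1) with hlam_def
  have hlam₀ : 0 ≤ lam := by positivity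
  refine sum_rejWeight_BH_le hS j (antitone_adaptiveLevel_pi0Storey hα hlam)
    (mul_nonneg hα (Finset.sum_nonneg fun x _ => ?_)) fun y => ?_
  · unfold storeyEValue
    split_ifs <;> positivity
  set c : ℝ := 1 + (Finset.univ.filter fun i => lam ≤ empPValue (swapped S j y) i).card with hc
  have hc₀ : 0 < c := by positivity
  rw [adaptiveLevel_pi0Storey hα hlam, ← hc]
  calc (ℓ + 1) * (α * (m * (1 - lam)) / c / m) = α * ((ℓ + 1) * (1 - lam) * (1 / c)) := by
        field_simp
    _ ≤ α * ((Finset.univ.filter fun x => lam < empPValue (swapped S j x) j).card * (1 / c)) := by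
        gcongr
        exact le_card_lt_empPValue_swapped hS j hlam₀
    _ ≤ α * ∑ x, storeyEValue H lam j (swapped S j x) := by
        unfold storeyEValue
        rw [← Finset.sum_filter, ← nsmul_eq_mul, ← Finset.sum_const]
        gcongr with x hx
        · simp only [Finset.mem_filter, Finset.mem_univ, true_and] at hx
          exact_mod_cast Finset.card_pos.2 ⟨j, Finset.mem_filter.2 ⟨hj, hx⟩⟩
        · rw [hc]
          have := card_lt_empPValue_swapped_le H K S j x y
          rw [← hlam_def] at this
          exact_mod_cast this

end Storey

/-! ### The quantile estimator -/

section Quantile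

variable {ℓ m : ℕ}

theorem orderStat_le_iff (p : Fin m → ℝ) {r : ℕ} (hr : 1 ≤ r ∧ r ≤ m) (t : ℝ) :
    orderStat p r hr ≤ t ↔ r ≤ (Finset.univ.filter fun i => p i ≤ t).card := by
  have h := Tuple.lt_card_le_iff_apply_le_of_monotone (a := t) (j := ⟨r - 1, by omega⟩)
    (Tuple.monotone_sort p)
  have hcard : (Finset.univ.filter fun i => (p ∘ Tuple.sort p) i ≤ t).card =
      (Finset.univ.filter fun i => p i ≤ t).card :=
    Finset.card_equiv (Tuple.sort p) (by simp)
  rw [hcard] at h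
  refine h.symm.trans ?_
  simp only
  omega

theorem orderStat_mono {r : ℕ} (hr : 1 ≤ r ∧ r ≤ m) :
    Monotone fun p : Fin m → ℝ => orderStat p r hr := by
  intro p q hpq
  refine (orderStat_le_iff p hr _).2 (((orderStat_le_iff q hr _).1 le_rfl).trans ?_)
  gcongr with i
  exact hpq i

theorem adaptiveLevel_pi0Quant {α : ℝ} (hα : 0 ≤ α) {k₀ : ℕ} (hk₀ : 1 ≤ k₀ ∧ k₀ ≤ m)
    (p : Fin m → ℝ) :
    adaptiveLevel α (pi0Quant k₀ hk₀ p) =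
      α * (m * max (1 - orderStat p k₀ hk₀) 0) / (m - k₀ + 1 : ℕ) := by
  -- If the order statistic is at least `1`, both sides vanish: the estimate is `∞` on the left.
  rw [adaptiveLevel, pi0Quant, ENNReal.toReal_div, ENNReal.toReal_div, ENNReal.toReal_mul,
    ENNReal.toReal_ofReal hα, ENNReal.toReal_ofReal', div_div_eq_mul_div,
    ENNReal.toReal_natCast, ENNReal.toReal_natCast]

theorem antitone_adaptiveLevel_pi0Quant {α : ℝ} (hα : 0 ≤ α) {k₀ : ℕ} (hk₀ : 1 ≤ k₀ ∧ k₀ ≤ m) :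
    Antitone fun p : Fin m → ℝ => adaptiveLevel α (pi0Quant k₀ hk₀ p) := by
  intro p q hpq
  simp only [adaptiveLevel_pi0Quant hα]
  gcongr
  exact orderStat_mono hk₀ hpq

/-- The e-value of `j` for the quantile estimator: equal shares for the `m - k₀ + 1` test positions
whose score is not among the `k₀ - 1` largest test scores, and `0` for the other ones. -/
noncomputable def quantileEValue (k₀ : ℕ) (j : Fin m) (S : Fin ℓ ⊕ Fin m → ℝ) : ℝ :=
  if k₀ - 1 ≤ (Finset.univ.filter fun i => S (Sum.inr j) < S (Sum.inr i)).card then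
    1 / ((m - k₀ + 1 : ℕ) : ℝ) else 0

theorem orderDetermined_quantileEValue (k₀ : ℕ) (j : Fin m) :
    OrderDetermined (quantileEValue (ℓ := ℓ) k₀ j) := by
  intro S T h
  simp only [quantileEValue, h]

theorem quantileEValue_nonneg (k₀ : ℕ) (j : Fin m) (S : Fin ℓ ⊕ Fin m → ℝ) :
    0 ≤ quantileEValue k₀ j S := by
  unfold quantileEValue
  split_ifs <;> positivity

theorem sum_quantileEValue_le_one {k₀ : ℕ} (hk₀ : 1 ≤ k₀ ∧ k₀ ≤ m) (H : Finset (Fin m))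
    {S : Fin ℓ ⊕ Fin m → ℝ} (hS : Function.Injective S) :
    ∑ j ∈ H, quantileEValue k₀ j S ≤ 1 := by
  refine (Finset.sum_le_sum_of_subset_of_nonneg (Finset.subset_univ H)
    fun j _ _ => quantileEValue_nonneg k₀ j S).trans ?_
  unfold quantileEValue
  rw [← Finset.sum_filter, Finset.sum_const, nsmul_eq_mul, mul_one_div]
  refine div_le_one_of_le₀ (Nat.cast_le.2 ?_) (by positivity)
  refine (card_filter_le_card_lt_le (hS.comp Sum.inr_injective) (k₀ - 1)).trans ?_
  rw [Fintype.card_fin]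
  omega

/-- If after some swap the `j`-th p-value exceeds the `k₀`-th smallest p-value found after another
swap, then at least `k₀ - 1` test scores exceed that of `j`. -/
theorem le_card_lt_swapped {S : Fin ℓ ⊕ Fin m → ℝ} (hS : Function.Injective S) {j : Fin m}
    {k₀ : ℕ} (hk₀ : 1 ≤ k₀ ∧ k₀ ≤ m) {x y : Option (Fin ℓ)}
    (h : orderStat (empPValue (swapped S j y)) k₀ hk₀ < empPValue (swapped S j x) j) :
    k₀ - 1 ≤ (Finset.univ.filter fun i =>
      swapped S j x (Sum.inr j) < swapped S j x (Sum.inr i)).card := by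
  have hcard := (orderStat_le_iff (empPValue (swapped S j y)) hk₀ _).1 le_rfl
  refine (Nat.sub_le_sub_right hcard 1).trans (Finset.pred_card_le_card_erase.trans
    (Finset.card_le_card (s := Finset.erase _ j) fun i hi => ?_))
  simp only [Finset.mem_erase, Finset.mem_filter, Finset.mem_univ, true_and] at hi ⊢
  rw [swapped_inr_self, swapped_inr_of_ne S hi.1]
  exact lt_of_empPValue_swapped_lt hS hi.1 (hi.2.trans_lt h)

theorem quantile_sum_swapped_le {S : Fin ℓ ⊕ Fin m → ℝ} (hS : Function.Injective S) (j : Fin m)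
    {α : ℝ} (hα : 0 ≤ α) {k₀ : ℕ} (hk₀ : 1 ≤ k₀ ∧ k₀ ≤ m) :
    ∑ x, rejWeight (BH (adaptiveLevel α (pi0Quant k₀ hk₀
        (empPValue (swapped S j x)))) (empPValue (swapped S j x))) j ≤
      α * ∑ x, quantileEValue k₀ j (swapped S j x) := by
  have hm : (m : ℝ) ≠ 0 := Nat.cast_ne_zero.2 (Fin.pos j).ne'
  refine sum_rejWeight_BH_le hS j (antitone_adaptiveLevel_pi0Quant hα hk₀)
    (mul_nonneg hα (Finset.sum_nonneg fun x _ => quantileEValue_nonneg _ _ _)) fun y => ?_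
  rw [adaptiveLevel_pi0Quant hα]
  set t := orderStat (empPValue (swapped S j y)) k₀ hk₀ with ht
  have ht₀ : 0 ≤ t := (empPValue_pos _ _).le
  set c : ℝ := ((m - k₀ + 1 : ℕ) : ℝ) with hc
  have hc₀ : 0 < c := by positivity
  calc (ℓ + 1) * (α * (m * max (1 - t) 0) / c / m) = α * ((ℓ + 1) * max (1 - t) 0 * (1 / c)) := by
        field_simp
    _ ≤ α * ((Finset.univ.filter fun x => t < empPValue (swapped S j x) j).card * (1 / c)) := by
        gcongr
        rcases le_total (1 - t) 0 with h | h
        · rw [max_eq_right h, mul_zero]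
          positivity
        · rw [max_eq_left h]
          exact le_card_lt_empPValue_swapped hS j ht₀
    _ ≤ α * ∑ x, quantileEValue k₀ j (swapped S j x) := by
        unfold quantileEValue
        rw [← Finset.sum_filter, ← nsmul_eq_mul, ← Finset.sum_const]
        gcongr ?_ * ?_
        refine Finset.sum_le_sum_of_subset_of_nonneg (fun x hx => ?_) fun _ _ _ => by positivity
        simp only [Finset.mem_filter, Finset.mem_univ, true_and] at hx ⊢
        exact le_card_lt_swapped hS hk₀ hx

end Quantile

end AdaDetect

theorem corollary3p5 {𝒵 : Type*} [MeasurableSpace 𝒵] {k ℓ m : ℕ}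
    (P : Measure (AdaDetect.Pos k ℓ m → 𝒵)) [IsProbabilityMeasure P] (P₀ : Measure 𝒵)
    (hP₀ : AdaDetect.NullMarginal P P₀)
    (hexch : AdaDetect.CondExchangeable P
      (AdaDetect.nullPositions k ℓ (AdaDetect.trueNulls P P₀)))
    (g : 𝒵 → (Fin k → 𝒵) → (Fin ℓ ⊕ Fin m → 𝒵) → ℝ) (hg : AdaDetect.IsScoreFunction g)
    (hties : AdaDetect.NoTies P g) (α : ℝ) (hα : 0 < α) :
    (∀ K : ℕ, 2 ≤ K → K ≤ ℓ →
      AdaDetect.ControlsFDR P P₀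
        (AdaDetect.storeyAdaDetect g α ((K : ℝ) / ((ℓ : ℝ) + 1))) α) ∧
    (∀ (k₀ : ℕ) (hk₀ : 1 ≤ k₀ ∧ k₀ ≤ m),
      AdaDetect.ControlsFDR P P₀ (AdaDetect.quantileAdaDetect g α k₀ hk₀) α) := by
  classical
  refine ⟨fun K _ hK => ?_, fun k₀ hk₀ => ?_⟩
  · exact AdaDetect.controlsFDR_of_sum_swapped_le hexch hg hties hα.le
      (AdaDetect.orderDetermined_empPValue.comp fun p => AdaDetect.BH (AdaDetect.adaptiveLevel α
        (AdaDetect.pi0Storey ((K : ℝ) / (ℓ + 1)) p)) p)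
      (fun j => AdaDetect.orderDetermined_storeyEValue
        (Finset.univ.filter (· ∈ AdaDetect.trueNulls P P₀)) _ j)
      (fun S hS j hj => AdaDetect.storey_sum_swapped_le hS (by simpa using hj) hα.le hK)
      (fun S _ => AdaDetect.sum_storeyEValue_le_one _ _ S)
  · exact AdaDetect.controlsFDR_of_sum_swapped_le hexch hg hties hα.le
      (AdaDetect.orderDetermined_empPValue.comp fun p => AdaDetect.BH (AdaDetect.adaptiveLevel α
        (AdaDetect.pi0Quant k₀ hk₀ p)) p)
      (AdaDetect.orderDetermined_quantileEValue k₀)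
      (fun S hS j _ => AdaDetect.quantile_sum_swapped_le hS j hα.le hk₀)
      (fun S hS => AdaDetect.sum_quantileEValue_le_one hk₀ _ hS)
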